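/- Let $\alpha>0$ and $-1<r<1$, put $\beta=\alpha\sqrt{1-r^2}$, $\kappa(x,y)=\exp[-\alpha(x^2+y^2)+2\alpha r xy]$ for $x,y\in\mathbb R$, and consider the integral operator $(K\varphi)(x)=\int_{\mathbb R}\kappa(x,y)\varphi(y)\,dy$ on $L^2(\mathbb R)$ (real- or complex-valued functions, Lebesgue measure); an eigenfunction with eigenvalue $\mu$ is a $\varphi\in L^2(\mathbb R)$, not a.e. zero, with $K\varphi=\mu\varphi$ a.e. Let $H_n(\eta)=\frac{d^n}{ds^n}e^{-s^2+2\eta s}\big|_{s=0}$ be the Hermite polynomials, and for $n=0,1,2,\dots$ put $$\varphi_n(x)=e^{-\beta x^2}H_n(\sqrt{2\beta}\,x),\qquad \mu_n=\sqrt{\frac{\pi}{\alpha+\beta}}\left(\frac{\alpha r}{\alpha+\beta}\right)^n .$$ Then: 1. For every $\varphi\in L^2(\mathbb R)$ the integral $(K\varphi)(x)$ converges absolutely for every $x$, and $K\varphi\in L^2(\mathbb R)$. 2. For every $n$, $\varphi_n$ is an eigenfunction of $K$ with eigenvalue $\mu_n$, and $(K\varphi_n)(x)=\mu_n\varphi_n(x)$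 for every $x\in\mathbb R$. 3. The eigenfunctions are complete: for suitable normalization constants $N_n>0$ the functions $N_n\varphi_n$, $n\ge 0$, form an orthonormal basis of $L^2(\mathbb R)$. They are the eigenfunctions of a harmonic oscillator: $-\tfrac12\varphi_n''+\tfrac12(2\beta)^2x^2\varphi_n=2\beta\,(n+\tfrac12)\,\varphi_n$. 4. The set of all eigenvalues of $K$ is $\{\mu_n: n\ge 0\}$, and if $\mu_n\neq0$, then the eigenfunctions with eigenvalue $\mu_n$ are exactly the functions that agree a.e. with a nonzero multiple of $\varphi_n$. 5. $\sum_{n=0}^\infty\mu_n=\sqrt{\frac{\pi}{2\alpha(1-r)}}=\int_{\mathbb R}\kappa(x,x)\,dx$, where the series and the integral converge. 6. The Gaussian eigenfunction gives the largest eigenvalue: $\mu_0=\sqrt{\pi/(\alpha+\beta)}$ is the largest real eigenvalue of $K$, every other eigenvalue $\mu$ satisfies $|\mu|<\mu_0$, and the eigenfunctions with eigenvalue $\mu_0$ are exactly the functions that agree a.e. with a nonzero multiple of $e^{-\beta x^2}$. -/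

import Mathlib

open MeasureTheory

noncomputable section

namespace GaussKernel

/-- The basic Gaussian kernel `κ(x,y) = exp[-α(x² + y²) + 2αrxy]`. -/
def kernel (α r x y : ℝ) : ℝ :=
  Real.exp (-α * (x ^ 2 + y ^ 2) + 2 * α * r * x * y)

/-- The exponent `β = α √(1 - r²)`. -/
def beta (α r : ℝ) : ℝ := α * √(1 - r ^ 2)

/-- The Hermite polynomial `H_n(η) = dⁿ/dsⁿ e^{-s² + 2ηs}` at `s = 0`. -/
def hermiteH (n : ℕ) (η : ℝ) : ℝ :=
  iteratedDeriv n (fun s : ℝ => Real.exp (-s ^ 2 + 2 * η * s)) 0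

/-- The unnormalized function `φ_n(x) = e^{-βx²} H_n(√(2β) x)`. -/
def phi (α r : ℝ) (n : ℕ) (x : ℝ) : ℝ :=
  Real.exp (-beta α r * x ^ 2) * hermiteH n (√(2 * beta α r) * x)

/-- The number `μ_n = √(π/(α+β)) (αr/(α+β))ⁿ`. -/
def mu (α r : ℝ) (n : ℕ) : ℝ :=
  √(Real.pi / (α + beta α r)) * (α * r / (α + beta α r)) ^ n

variable {𝕜 : Type*} [RCLike 𝕜]

/-- The integral operator `(Kf)(x) = ∫ κ(x,y) f(y) dy`. -/
def integralOp (α r : ℝ) (f : ℝ → 𝕜) (x : ℝ) : 𝕜 :=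
  ∫ y : ℝ, (kernel α r x y : 𝕜) * f y

/-- `f` is an eigenfunction of the integral operator in `L²(ℝ)` with eigenvalue `m`:
a square integrable function that is not a.e. zero and satisfies `Kf = m f` a.e. -/
def IsEigenfunction (α r : ℝ) (m : 𝕜) (f : ℝ → 𝕜) : Prop :=
  MemLp f 2 (volume : Measure ℝ) ∧ ¬ (f =ᵐ[volume] 0) ∧
    ∀ᵐ x : ℝ, integralOp α r f x = m * f x

/-- `m` is an eigenvalue of the integral operator in `L²(ℝ)`. -/
def IsEigenvalue (α r : ℝ) (m : 𝕜) : Prop :=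
  ∃ f : ℝ → 𝕜, IsEigenfunction α r m f

end GaussKernel

end

noncomputable section

namespace GaussKernel

/-! Write `h n` for the Hermite function with `b = β` and `t = αr/(α+β)`. Integrating the
`y`-derivative of `κ(x,y) h n y` to zero gives a three-term recursion for `K (h n)`. Since
`(α-β)(α+β) = (αr)²`, this is the recursion of `h n` itself, with an extra factor `t` on its first
term and `t²` on its second; hence `K (h n) = μ_n h n` by induction from the Gaussian `h 0`
(`integral_kernel_mul_hermiteFn`).

The rest needs no compactness or spectral theorem. The `h n` are orthogonal and total in `L²`
(`ae_eq_zero_of_integral_hermiteFn`). As `κ` is symmetric, Fubini shows that `K` multiplies the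
`n`-th Hermite coefficient by `μ_n`. So `K f = m f` forces `(m - μ_n) c_n = 0` for all `n`: some
`μ_n` equals `m`, and since a nonzero `μ_n` differs from all the others, only one coefficient
survives. The bound `|t| < 1` gives the largest eigenvalue and sums the trace as a geometric series.
-/

open Polynomial in
/-- The Hermite polynomials of the physicists, `H_{n+1} = 2 X H_n - H_n'`. -/
def hermitePoly : ℕ → ℝ[X]
  | 0 => 1
  | n + 1 => 2 * X * hermitePoly n - derivative (hermitePoly n)

open Polynomial in
theorem derivative_hermitePoly_succ (n : ℕ) :
    derivative (hermitePoly (n + 1)) = C (2 * ((n : ℝ) + 1)) * hermitePoly n := by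
  induction n with
  | zero => simpa [hermitePoly] using (C_ofNat (R := ℝ) 2).symm
  | succ n ih =>
    have h : derivative (hermitePoly (n + 2)) = 2 * hermitePoly (n + 1)
        + 2 * X * derivative (hermitePoly (n + 1))
        - derivative (derivative (hermitePoly (n + 1))) := by
      rw [hermitePoly]
      simp only [derivative_sub, derivative_mul, derivative_ofNat, derivative_X]
      ring
    rw [h, ih, derivative_C_mul]
    have h' : 2 * X * hermitePoly n - derivative (hermitePoly n) = hermitePoly (n + 1) := rfl
    have h2 : (C (2 * (((n + 1 : ℕ) : ℝ) + 1)) : ℝ[X]) = 2 + C (2 * ((n : ℝ) + 1)) := by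
      have : (2 : ℝ[X]) = C 2 := rfl
      rw [this, ← C_add]
      congr 1
      push_cast
      ring
    rw [h2, ← h']
    ring

/-- At `n = 0` the truncated index `n - 1` is harmless because the factor `2n` vanishes; later
recursions rely on the same convention. -/
theorem derivative_hermitePoly (n : ℕ) :
    Polynomial.derivative (hermitePoly n) = Polynomial.C (2 * (n : ℝ)) * hermitePoly (n - 1) := by
  cases n with
  | zero => simp [hermitePoly]
  | succ n => rw [derivative_hermitePoly_succ]; simp

/-- Keeping `s` free, rather than `s = 0`, is what makes the induction close. -/
theorem iteratedDeriv_exp_generating (n : ℕ) (η : ℝ) :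
    iteratedDeriv n (fun s : ℝ => Real.exp (-s ^ 2 + 2 * η * s)) =
      fun s => (hermitePoly n).eval (η - s) * Real.exp (-s ^ 2 + 2 * η * s) := by
  induction n with
  | zero => simp [hermitePoly]
  | succ n ih =>
    rw [iteratedDeriv_succ, ih]
    funext s
    have h1 : HasDerivAt (fun s : ℝ => η - s) (-1) s := by
      simpa using (hasDerivAt_id s).const_sub η
    have h2 := ((hermitePoly n).hasDerivAt (η - s)).comp s h1
    have h3 : HasDerivAt (fun s : ℝ => -s ^ 2 + 2 * η * s) (-(2 * s) + 2 * η) s := by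
      exact ((hasDerivAt_pow 2 s).neg.add ((hasDerivAt_id s).const_mul (2 * η))).congr_deriv
        (by simp)
    have h4 := (h2.mul h3.exp).deriv
    simp only [Function.comp_def, Pi.mul_def] at h4
    rw [h4, hermitePoly]
    simp only [Polynomial.eval_sub, Polynomial.eval_mul, Polynomial.eval_X,
      Polynomial.eval_ofNat]
    ring

theorem hermiteH_eq_eval (n : ℕ) (η : ℝ) : hermiteH n η = (hermitePoly n).eval η := by
  rw [hermiteH, iteratedDeriv_exp_generating]
  simp

/-! ### Hermite functions: ladder relations and the oscillator equation -/

/-- The Hermite function `e^{-bx²} H_n(√(2b) x)`. -/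
def hermiteFn (b : ℝ) (n : ℕ) (x : ℝ) : ℝ :=
  Real.exp (-b * x ^ 2) * (hermitePoly n).eval (√(2 * b) * x)

theorem phi_eq_hermiteFn (α r : ℝ) (n : ℕ) : phi α r n = hermiteFn (beta α r) n := by
  funext x
  rw [phi, hermiteFn, hermiteH_eq_eval]

theorem hermiteFn_zero (b x : ℝ) : hermiteFn b 0 x = Real.exp (-b * x ^ 2) := by
  simp [hermiteFn, hermitePoly]

theorem hermiteFn_succ (b : ℝ) (n : ℕ) (x : ℝ) :
    hermiteFn b (n + 1) x =
      2 * √(2 * b) * x * hermiteFn b n x - 2 * n * hermiteFn b (n - 1) x := by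
  simp only [hermiteFn, hermitePoly, derivative_hermitePoly, Polynomial.eval_sub,
    Polynomial.eval_mul, Polynomial.eval_X, Polynomial.eval_ofNat, Polynomial.eval_C]
  ring

theorem hasDerivAt_hermiteFn {b : ℝ} (hb : 0 < b) (n : ℕ) (x : ℝ) :
    HasDerivAt (hermiteFn b n)
      (2 * b * x * hermiteFn b n x - √(2 * b) * hermiteFn b (n + 1) x) x := by
  have hs : √(2 * b) * √(2 * b) = 2 * b := Real.mul_self_sqrt (by positivity)
  have h1 : HasDerivAt (fun x : ℝ => √(2 * b) * x) (√(2 * b)) x := by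
    simpa using (hasDerivAt_id x).const_mul (√(2 * b))
  have h2 := ((hermitePoly n).hasDerivAt (√(2 * b) * x)).comp x h1
  have h3 : HasDerivAt (fun x : ℝ => -b * x ^ 2) (-b * (2 * x)) x := by
    simpa using (hasDerivAt_pow 2 x).const_mul (-b)
  refine (h3.exp.mul h2).congr_deriv ?_
  simp only [hermiteFn, hermitePoly, Function.comp_apply, Polynomial.eval_sub,
    Polynomial.eval_mul, Polynomial.eval_X, Polynomial.eval_ofNat]
  linear_combination (2 * x * Real.exp (-b * x ^ 2) *
    (hermitePoly n).eval (√(2 * b) * x)) * hs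

theorem hasDerivAt_hermiteFn' {b : ℝ} (hb : 0 < b) (n : ℕ) (x : ℝ) :
    HasDerivAt (hermiteFn b n)
      (-(2 * b * x * hermiteFn b n x) + 2 * n * √(2 * b) * hermiteFn b (n - 1) x) x := by
  have hs : √(2 * b) * √(2 * b) = 2 * b := Real.mul_self_sqrt (by positivity)
  refine (hasDerivAt_hermiteFn hb n x).congr_deriv ?_
  rw [hermiteFn_succ]
  linear_combination (-2 * x * hermiteFn b n x) * hs

theorem continuous_hermiteFn (b : ℝ) (n : ℕ) : Continuous (hermiteFn b n) := by
  unfold hermiteFn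
  fun_prop

theorem hermiteFn_oscillator {b : ℝ} (hb : 0 < b) (n : ℕ) (x : ℝ) :
    -(1 / 2) * iteratedDeriv 2 (hermiteFn b n) x
        + (1 / 2) * (2 * b) ^ 2 * x ^ 2 * hermiteFn b n x =
      2 * b * ((n : ℝ) + 1 / 2) * hermiteFn b n x := by
  have hs : √(2 * b) * √(2 * b) = 2 * b := Real.mul_self_sqrt (by positivity)
  have h1 : deriv (hermiteFn b n) =
      fun x => 2 * b * x * hermiteFn b n x - √(2 * b) * hermiteFn b (n + 1) x :=
    funext fun x => (hasDerivAt_hermiteFn hb n x).deriv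
  have h2 : HasDerivAt (fun x : ℝ => 2 * b * x) (2 * b) x := by
    simpa using (hasDerivAt_id x).const_mul (2 * b)
  -- Raising `n` and then lowering `n + 1` returns to `n`; the `h (n + 1)` terms cancel.
  have h3 := ((h2.mul (hasDerivAt_hermiteFn hb n x)).sub
    ((hasDerivAt_hermiteFn' hb (n + 1) x).const_mul (√(2 * b)))).deriv
  rw [iteratedDeriv_succ, iteratedDeriv_one, h1]
  simp only [Pi.mul_def, Pi.sub_def] at h3
  rw [h3]
  simp only [Nat.add_sub_cancel]
  push_cast
  linear_combination ((n + 1) * hermiteFn b n x) * hs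

/-! ### Integrability of polynomials times Gaussians -/

theorem integrable_pow_mul_exp_neg_mul_sq {b : ℝ} (hb : 0 < b) (k : ℕ) :
    Integrable fun x : ℝ => x ^ k * Real.exp (-b * x ^ 2) := by
  have h : (-1 : ℝ) < k := lt_of_lt_of_le (by norm_num) (Nat.cast_nonneg k)
  simpa using integrable_rpow_mul_exp_neg_mul_sq hb h

theorem integrable_eval_mul_exp_neg_mul_sq {b : ℝ} (hb : 0 < b) (p : Polynomial ℝ) :
    Integrable fun x : ℝ => p.eval x * Real.exp (-b * x ^ 2) := by
  induction p using Polynomial.induction_on' with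
  | add p q hp hq =>
    exact (hp.add hq).congr (Filter.Eventually.of_forall fun x => by simp [add_mul])
  | monomial n a =>
    simpa [mul_assoc] using (integrable_pow_mul_exp_neg_mul_sq hb n).const_mul a

theorem memLp_eval_mul_exp_neg_mul_sq {b : ℝ} (hb : 0 < b) (p : Polynomial ℝ) :
    MemLp (fun x : ℝ => p.eval x * Real.exp (-b * x ^ 2)) 2 := by
  rw [memLp_two_iff_integrable_sq (by fun_prop)]
  refine (integrable_eval_mul_exp_neg_mul_sq (b := 2 * b) (by positivity) (p ^ 2)).congr
    (Filter.Eventually.of_forall fun x => ?_)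
  simp only [Polynomial.eval_pow, mul_pow]
  rw [← Real.exp_nat_mul]
  congr 2
  push_cast
  ring

theorem memLp_pow_mul_hermiteFn {b : ℝ} (hb : 0 < b) (k n : ℕ) :
    MemLp (fun x => x ^ k * hermiteFn b n x) 2 := by
  refine (memLp_congr_ae (Filter.Eventually.of_forall fun x => ?_)).1
    (memLp_eval_mul_exp_neg_mul_sq hb (Polynomial.X ^ k *
      (hermitePoly n).comp (Polynomial.C (√(2 * b)) * Polynomial.X)))
  simp [hermiteFn]
  ring

theorem memLp_hermiteFn {b : ℝ} (hb : 0 < b) (n : ℕ) : MemLp (hermiteFn b n) 2 := by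
  simpa using memLp_pow_mul_hermiteFn hb 0 n

/-! ### Orthogonality -/

/-- The derivative of `h n * h m` integrates to zero; with the raising form on one factor and the
lowering form on the other, the `2bx` terms cancel. -/
theorem integral_hermiteFn_succ_mul {b : ℝ} (hb : 0 < b) (n m : ℕ) :
    ∫ x, hermiteFn b (n + 1) x * hermiteFn b m x =
      2 * m * ∫ x, hermiteFn b n x * hermiteFn b (m - 1) x := by
  have hs : 0 < √(2 * b) := by positivity
  have hI : ∀ i j, Integrable fun x => hermiteFn b i x * hermiteFn b j x := fun i j =>
    (memLp_hermiteFn hb i).integrable_mul (memLp_hermiteFn hb j)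
  have hd : ∀ x, HasDerivAt (fun x => hermiteFn b n x * hermiteFn b m x)
      (√(2 * b) * (2 * m * (hermiteFn b n x * hermiteFn b (m - 1) x)
        - hermiteFn b (n + 1) x * hermiteFn b m x)) x := fun x => by
    refine ((hasDerivAt_hermiteFn hb n x).mul (hasDerivAt_hermiteFn' hb m x)).congr_deriv ?_
    ring
  have h := integral_eq_zero_of_hasDerivAt_of_integrable hd
    ((((hI n (m - 1)).const_mul (2 * m)).sub (hI (n + 1) m)).const_mul _) (hI n m)
  rw [integral_const_mul, integral_sub ((hI n (m - 1)).const_mul (2 * m)) (hI (n + 1) m),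
    integral_const_mul] at h
  have := (mul_eq_zero.1 h).resolve_left hs.ne'
  linarith

theorem integral_hermiteFn_mul_of_lt {b : ℝ} (hb : 0 < b) (n m : ℕ) (h : m < n) :
    ∫ x, hermiteFn b n x * hermiteFn b m x = 0 := by
  induction n generalizing m with
  | zero => omega
  | succ n ih =>
    rw [integral_hermiteFn_succ_mul hb]
    cases m with
    | zero => simp
    | succ m => rw [Nat.add_sub_cancel, ih m (by omega), mul_zero]

theorem integral_hermiteFn_mul_of_ne {b : ℝ} (hb : 0 < b) {n m : ℕ} (h : n ≠ m) :
    ∫ x, hermiteFn b n x * hermiteFn b m x = 0 := by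
  rcases lt_or_gt_of_ne h with h | h
  · simpa [mul_comm] using integral_hermiteFn_mul_of_lt hb m n h
  · exact integral_hermiteFn_mul_of_lt hb n m h

theorem integral_hermiteFn_mul_self_pos {b : ℝ} (hb : 0 < b) (n : ℕ) :
    0 < ∫ x, hermiteFn b n x * hermiteFn b n x := by
  induction n with
  | zero =>
    have : ∀ x, hermiteFn b 0 x * hermiteFn b 0 x = Real.exp (-(2 * b) * x ^ 2) := fun x => by
      rw [hermiteFn_zero, ← Real.exp_add]
      congr 1
      ring
    simp only [this, integral_gaussian]
    positivity
  | succ n ih =>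
    rw [integral_hermiteFn_succ_mul hb, Nat.add_sub_cancel]
    positivity

/-! ### Totality of the Hermite functions -/

-- A test function is the Fourier transform of a Schwartz function `Φ`, and moving the transform
-- across the integral pairs `Φ` with `𝓕 g = 0`.
open FourierTransform SchwartzMap in
theorem ae_eq_zero_of_fourier_eq_zero {g : ℝ → ℂ} (hg : Integrable g)
    (h : ∀ ξ, 𝓕 g ξ = 0) : g =ᵐ[volume] 0 := by
  refine ae_eq_zero_of_integral_contDiff_smul_eq_zero hg.locallyIntegrable fun ψ hψ hψc => ?_
  have h₁ : HasCompactSupport (Complex.ofRealCLM ∘ ψ) := hψc.comp_left rfl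
  have h₂ : ContDiff ℝ (⊤ : ℕ∞) (Complex.ofRealCLM ∘ ψ) := Complex.ofRealCLM.contDiff.comp hψ
  let Ψ : 𝓢(ℝ, ℂ) := h₁.toSchwartzMap h₂
  have h3 : ∀ x, Ψ x = (ψ x : ℂ) := fun _ => rfl
  let Φ : 𝓢(ℝ, ℂ) := 𝓕⁻ Ψ
  have h4 : ∫ ξ, 𝓕 (Φ : ℝ → ℂ) ξ • g ξ = ∫ x, Φ x • 𝓕 g x := by
    simpa only [flip_innerₗ] using! VectorFourier.integral_fourierIntegral_smul_eq_flip
      (L := innerₗ ℝ) Real.continuous_fourierChar continuous_inner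
      (Φ.integrable (μ := volume)) hg
  have h5 : 𝓕 Φ = Ψ := FourierTransform.fourier_fourierInv_eq Ψ
  rw [← SchwartzMap.fourier_coe, h5] at h4
  simpa [h3, h] using h4

theorem mul_abs_le_sq (b c x : ℝ) (hb : 0 < b) :
    -b * x ^ 2 + c * |x| ≤ c ^ 2 / (2 * b) + -(b / 2) * x ^ 2 := by
  have : c ^ 2 / (2 * b) + -(b / 2) * x ^ 2 - (-b * x ^ 2 + c * |x|)
      = (c - b * |x|) ^ 2 / (2 * b) := by
    have := sq_abs x
    field_simp
    rw [← this]
    ring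
  have h2 : 0 ≤ (c - b * |x|) ^ 2 / (2 * b) := by positivity
  linarith

theorem integrable_exp_mul_abs_mul {b : ℝ} (hb : 0 < b) (c : ℝ) {f : ℝ → ℝ} (hf : MemLp f 2) :
    Integrable fun x => |f x| * Real.exp (-b * x ^ 2 + c * |x|) := by
  have h1 : MemLp (fun x : ℝ => Real.exp (-(b / 2) * x ^ 2)) 2 := by
    simpa using memLp_eval_mul_exp_neg_mul_sq (half_pos hb) 1
  refine ((hf.integrable_mul h1).norm.const_mul (Real.exp (c ^ 2 / (2 * b)))).mono'
    (hf.1.norm.mul (by fun_prop)) (Filter.Eventually.of_forall fun x => ?_)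
  have h2 := Real.exp_le_exp.2 (mul_abs_le_sq b c x hb)
  rw [Real.exp_add (c ^ 2 / (2 * b))] at h2
  simp only [norm_mul, Real.norm_eq_abs, abs_abs, Pi.mul_apply, Real.abs_exp]
  calc _ ≤ |f x| * (Real.exp (c ^ 2 / (2 * b)) * Real.exp (-(b / 2) * x ^ 2)) := by gcongr
    _ = _ := by ring

open FourierTransform in
/-- A square integrable function all of whose Gaussian-weighted moments vanish is zero. -/
theorem ae_eq_zero_of_moments {b : ℝ} (hb : 0 < b) {f : ℝ → ℝ} (hf : MemLp f 2)
    (h : ∀ k : ℕ, ∫ x, x ^ k * (Real.exp (-b * x ^ 2) * f x) = 0) : f =ᵐ[volume] 0 := by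
  set g : ℝ → ℂ := fun x => ((Real.exp (-b * x ^ 2) * f x : ℝ) : ℂ) with hg
  have hgm : AEStronglyMeasurable g volume :=
    Complex.continuous_ofReal.comp_aestronglyMeasurable
      (AEStronglyMeasurable.mul (by fun_prop) hf.1)
  have hgn : ∀ x, ‖g x‖ = |f x| * Real.exp (-b * x ^ 2) := fun x => by
    rw [hg, Complex.norm_real, norm_mul, Real.norm_eq_abs, Real.abs_exp, Real.norm_eq_abs,
      mul_comm]
  have hgi : Integrable g := by
    refine (integrable_exp_mul_abs_mul hb 0 hf).mono' hgm (Filter.Eventually.of_forall fun x => ?_)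
    rw [hgn]
    simp
  have hF : ∀ ξ, 𝓕 g ξ = 0 := fun ξ => by
    set c : ℝ := 2 * Real.pi * |ξ|
    set w : ℂ := -(2 * Real.pi * ξ) * Complex.I with hw
    have hwn : ‖w‖ = c := by
      simp [hw, c, abs_of_pos Real.pi_pos]
    -- Expand the Fourier character in powers of `x`. The norms of the terms sum to `exp (c|x|) ‖g
    -- x‖`, which the Gaussian weight keeps integrable.
    have hs := hasSum_integral_of_dominated_convergence
      (F := fun (k : ℕ) (x : ℝ) => (w * x) ^ k / (k.factorial : ℂ) * g x)
      (f := fun x => Complex.exp (w * x) * g x) (μ := volume)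
      (fun k x => (c * |x|) ^ k / (k.factorial : ℝ) * ‖g x‖)
      (fun k => AEStronglyMeasurable.mul (by fun_prop) hgm)
      (fun k => Filter.Eventually.of_forall fun x => by simp [hwn])
      (Filter.Eventually.of_forall fun x => (Real.summable_pow_div_factorial _).mul_right _)
      (by
        refine (integrable_exp_mul_abs_mul hb c hf).congr (Filter.Eventually.of_forall fun x => ?_)
        simp only [tsum_mul_right, hgn]
        rw [(NormedSpace.expSeries_div_hasSum_exp (c * |x|)).tsum_eq, ← Real.exp_eq_exp_ℝ,
          Real.exp_add]
        ring)
      (Filter.Eventually.of_forall fun x => by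
        refine HasSum.mul_right _ ?_
        rw [Complex.exp_eq_exp_ℂ]
        exact NormedSpace.expSeries_div_hasSum_exp (w * x))
    have hz : ∀ k : ℕ, ∫ x : ℝ, (w * x) ^ k / (k.factorial : ℂ) * g x = 0 := fun k => by
      have : ∀ x : ℝ, (w * x) ^ k / (k.factorial : ℂ) * g x =
          (w ^ k / (k.factorial : ℂ)) *
            ((x ^ k * (Real.exp (-b * x ^ 2) * f x) : ℝ) : ℂ) := fun x => by
        rw [hg]
        push_cast
        ring
      simp only [this]
      rw [integral_const_mul, integral_complex_ofReal, h k]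
      simp
    simp only [hz] at hs
    have h0 := hs.unique hasSum_zero
    rw [Real.fourier_real_eq_integral_exp_smul, ← h0]
    refine integral_congr_ae (Filter.Eventually.of_forall fun x => ?_)
    simp only [smul_eq_mul, hw]
    congr 2
    push_cast
    ring
  filter_upwards [ae_eq_zero_of_fourier_eq_zero hgi hF] with x hx
  simpa [hg, (Real.exp_pos _).ne'] using hx

theorem ae_eq_zero_of_integral_hermiteFn_real {b : ℝ} (hb : 0 < b) {f : ℝ → ℝ} (hf : MemLp f 2)
    (h : ∀ n : ℕ, ∫ x, hermiteFn b n x * f x = 0) : f =ᵐ[volume] 0 := by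
  have hs : 0 < √(2 * b) := by positivity
  have hI : ∀ k n, Integrable fun x => x ^ k * hermiteFn b n x * f x := fun k n =>
    (memLp_pow_mul_hermiteFn hb k n).integrable_mul hf
  -- The recursion trades a power of `x` for a shift of `n` by one either way, so the induction on
  -- `k` treats all `n` at once; `n = 0` yields the Gaussian moments.
  have key : ∀ k n : ℕ, ∫ x, x ^ k * hermiteFn b n x * f x = 0 := fun k => by
    induction k with
    | zero => simpa using h
    | succ k ih =>
      intro n
      have hx : ∀ x, x ^ (k + 1) * hermiteFn b n x * f x =
          (1 / (2 * √(2 * b))) * (x ^ k * hermiteFn b (n + 1) x * f x +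
            2 * n * (x ^ k * hermiteFn b (n - 1) x * f x)) := fun x => by
        rw [hermiteFn_succ]
        field_simp
        ring
      simp only [hx]
      rw [integral_const_mul, integral_add (hI _ _) ((hI _ _).const_mul _), integral_const_mul,
        ih, ih]
      simp
  refine ae_eq_zero_of_moments hb hf fun k => ?_
  simpa [hermiteFn_zero, mul_assoc] using key k 0

/-- The Hermite functions are total in `L²`. -/
theorem ae_eq_zero_of_integral_hermiteFn {𝕜 : Type*} [RCLike 𝕜] {b : ℝ} (hb : 0 < b) {f : ℝ → 𝕜}
    (hf : MemLp f 2) (h : ∀ n : ℕ, ∫ x, (hermiteFn b n x : 𝕜) * f x = 0) : f =ᵐ[volume] 0 := by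
  have hI : ∀ n, Integrable fun x => (hermiteFn b n x : 𝕜) * f x := fun n =>
    (memLp_hermiteFn hb n).ofReal.integrable_mul hf
  have hre := ae_eq_zero_of_integral_hermiteFn_real hb hf.re fun n => by
    have := integral_re (hI n)
    rw [h n] at this
    simpa using this
  have him := ae_eq_zero_of_integral_hermiteFn_real hb hf.im fun n => by
    have := integral_im (hI n)
    rw [h n] at this
    simpa using this
  filter_upwards [hre, him] with x h1 h2
  exact RCLike.ext (by simpa using h1) (by simpa using h2)

/-! ### Estimates for the kernel and its parameters -/

section Kernel

variable {α r : ℝ}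

theorem beta_pos (hα : 0 < α) (hr : |r| < 1) : 0 < beta α r := by
  have : 0 < 1 - r ^ 2 := by nlinarith [(sq_lt_one_iff_abs_lt_one r).2 hr]
  unfold beta
  positivity

theorem beta_sq (hr : |r| < 1) : beta α r ^ 2 = α ^ 2 * (1 - r ^ 2) := by
  have : 0 ≤ 1 - r ^ 2 := by nlinarith [(sq_lt_one_iff_abs_lt_one r).2 hr]
  rw [beta, mul_pow, Real.sq_sqrt this]

theorem sub_beta_eq (hα : 0 < α) (hr : |r| < 1) :
    α - beta α r = (α * r / (α + beta α r)) ^ 2 * (α + beta α r) := by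
  have hb := beta_pos hα hr
  have h2 := beta_sq (α := α) hr
  field_simp
  linear_combination -h2

theorem ratio_abs_lt_one (hα : 0 < α) (hr : |r| < 1) : |α * r / (α + beta α r)| < 1 := by
  have hb := beta_pos hα hr
  rw [abs_div, abs_mul, abs_of_pos hα, abs_of_pos (by positivity : 0 < α + beta α r),
    div_lt_one (by positivity)]
  nlinarith

theorem kernel_symm (α r x y : ℝ) : kernel α r x y = kernel α r y x := by
  unfold kernel
  congr 1
  ring

theorem kernel_pos (α r x y : ℝ) : 0 < kernel α r x y := Real.exp_pos _

theorem continuous_kernel (α r : ℝ) : Continuous fun p : ℝ × ℝ => kernel α r p.1 p.2 := by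
  unfold kernel
  fun_prop

/-- From `2|xy| ≤ x² + y²`. Separating the variables lets one bound serve absolute convergence, the
mapping into `L²` and Fubini. -/
theorem kernel_le (hα : 0 < α) (x y : ℝ) :
    kernel α r x y ≤
      Real.exp (-(α * (1 - |r|)) * x ^ 2) * Real.exp (-(α * (1 - |r|)) * y ^ 2) := by
  rw [kernel, ← Real.exp_add, Real.exp_le_exp]
  have h1 : 2 * r * x * y ≤ |r| * (x ^ 2 + y ^ 2) := by
    rcases abs_cases r with ⟨h, h'⟩ | ⟨h, h'⟩ <;> rw [h]
    · nlinarith [mul_nonneg h' (sq_nonneg (x - y))]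
    · nlinarith [mul_nonneg (neg_nonneg.2 h'.le) (sq_nonneg (x + y))]
  nlinarith [mul_le_mul_of_nonneg_left h1 hα.le]

theorem decay_pos (hα : 0 < α) (hr : |r| < 1) : 0 < α * (1 - |r|) :=
  mul_pos hα (sub_pos.2 hr)

theorem memLp_exp_neg_mul_sq {b : ℝ} (hb : 0 < b) :
    MemLp (fun x : ℝ => Real.exp (-b * x ^ 2)) 2 := by
  simpa using memLp_eval_mul_exp_neg_mul_sq hb 1

end Kernel

/-! ### The operator on `L²` -/

section Operator

variable {𝕜 : Type*} [RCLike 𝕜] {α r : ℝ} {f : ℝ → 𝕜}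

theorem integrable_exp_mul_norm {b : ℝ} (hb : 0 < b) (hf : MemLp f 2) :
    Integrable fun y : ℝ => Real.exp (-b * y ^ 2) * ‖f y‖ :=
  (memLp_exp_neg_mul_sq hb).integrable_mul hf.norm

theorem norm_kernel_mul_le (hα : 0 < α) (x y : ℝ) (z : 𝕜) :
    ‖(kernel α r x y : 𝕜) * z‖ ≤ Real.exp (-(α * (1 - |r|)) * x ^ 2) *
      (Real.exp (-(α * (1 - |r|)) * y ^ 2) * ‖z‖) := by
  rw [norm_mul, RCLike.norm_ofReal, abs_of_pos (kernel_pos α r x y), ← mul_assoc]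
  gcongr
  exact kernel_le hα x y

theorem aestronglyMeasurable_kernel_mul (α r : ℝ) (hf : AEStronglyMeasurable f volume) :
    AEStronglyMeasurable (fun p : ℝ × ℝ => (kernel α r p.1 p.2 : 𝕜) * f p.2)
      (volume.prod volume) :=
  (RCLike.continuous_ofReal.comp (continuous_kernel α r)).aestronglyMeasurable.mul hf.comp_snd

theorem integrable_kernel_mul (hα : 0 < α) (hr : |r| < 1) (hf : MemLp f 2) (x : ℝ) :
    Integrable fun y : ℝ => (kernel α r x y : 𝕜) * f y := by
  refine ((integrable_exp_mul_norm (decay_pos hα hr) hf).const_mul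
    (Real.exp (-(α * (1 - |r|)) * x ^ 2))).mono' ?_
    (Filter.Eventually.of_forall fun y => norm_kernel_mul_le hα x y (f y))
  exact (RCLike.continuous_ofReal.comp ((continuous_kernel α r).comp
    (by fun_prop : Continuous fun y : ℝ => (x, y)))).aestronglyMeasurable.mul hf.1

theorem memLp_integralOp (hα : 0 < α) (hr : |r| < 1) (hf : MemLp f 2) :
    MemLp (integralOp α r f) 2 := by
  set c := α * (1 - |r|) with hc
  refine ((memLp_exp_neg_mul_sq (decay_pos hα hr)).const_mul
    (∫ y, Real.exp (-c * y ^ 2) * ‖f y‖)).of_le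
    (aestronglyMeasurable_kernel_mul α r hf.1).integral_prod_right'
    (Filter.Eventually.of_forall fun x => ?_)
  have h0 : 0 ≤ ∫ y, Real.exp (-c * y ^ 2) * ‖f y‖ := integral_nonneg fun y => by positivity
  rw [Real.norm_of_nonneg (mul_nonneg h0 (Real.exp_pos _).le), mul_comm, ← integral_const_mul]
  exact norm_integral_le_of_norm_le
    ((integrable_exp_mul_norm (decay_pos hα hr) hf).const_mul _)
    (Filter.Eventually.of_forall fun y => norm_kernel_mul_le hα x y (f y))

end Operator

/-! ### The eigenvalue equation -/

section Eigen

variable {α r : ℝ}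

theorem integral_kernel_mul_hermiteFn_zero (hα : 0 < α) (hr : |r| < 1) (x : ℝ) :
    ∫ y, kernel α r x y * hermiteFn (beta α r) 0 y =
      √(Real.pi / (α + beta α r)) * hermiteFn (beta α r) 0 x := by
  have hb := beta_pos hα hr
  have h1 := sub_beta_eq hα hr
  set t := α * r / (α + beta α r) with ht
  have h2 : t * (α + beta α r) = α * r := by rw [ht]; field_simp
  -- Complete the square in `y`: the centre is `t * x`, and `α - β = t²(α + β)` leaves exactly
  -- `-βx²`.
  have h3 : ∀ y, kernel α r x y * hermiteFn (beta α r) 0 y =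
      hermiteFn (beta α r) 0 x * Real.exp (-(α + beta α r) * (y - t * x) ^ 2) := fun y => by
    rw [hermiteFn_zero, hermiteFn_zero, kernel, ← Real.exp_add, ← Real.exp_add]
    congr 1
    linear_combination (-x ^ 2) * h1 - 2 * x * y * h2
  simp only [h3]
  rw [integral_const_mul, integral_sub_right_eq_self
    (fun y => Real.exp (-(α + beta α r) * y ^ 2)) (t * x), integral_gaussian, mul_comm]

theorem integral_kernel_mul_hermiteFn_succ (hα : 0 < α) (hr : |r| < 1) (n : ℕ) (x : ℝ) :
    (α + beta α r) * ∫ y, kernel α r x y * hermiteFn (beta α r) (n + 1) y =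
      2 * α * r * √(2 * beta α r) * x * (∫ y, kernel α r x y * hermiteFn (beta α r) n y)
        - 2 * n * (α - beta α r) *
          ∫ y, kernel α r x y * hermiteFn (beta α r) (n - 1) y := by
  have hb := beta_pos hα hr
  set b := beta α r
  have hs : 0 < √(2 * b) := by positivity
  have hss : √(2 * b) * √(2 * b) = 2 * b := Real.mul_self_sqrt (by positivity)
  have hI : ∀ k, Integrable fun y => kernel α r x y * hermiteFn b k y := fun k =>
    integrable_kernel_mul (𝕜 := ℝ) hα hr (memLp_hermiteFn hb k) x
  -- The factor `√(2b)` lets the three-term recursion remove `y * h n y`.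
  have hd : ∀ y, HasDerivAt (fun y => √(2 * b) * (kernel α r x y * hermiteFn b n y))
      (2 * α * r * √(2 * b) * x * (kernel α r x y * hermiteFn b n y)
        - (2 * n * (α - b) * (kernel α r x y * hermiteFn b (n - 1) y)
          + (α + b) * (kernel α r x y * hermiteFn b (n + 1) y))) y := fun y => by
    have h1 : HasDerivAt (fun y => -α * (x ^ 2 + y ^ 2) + 2 * α * r * x * y)
        (-α * (2 * y) + 2 * α * r * x) y :=
      ((((hasDerivAt_pow 2 y).const_add (x ^ 2)).const_mul (-α)).add
        ((hasDerivAt_id y).const_mul (2 * α * r * x))).congr_deriv (by simp)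
    refine ((h1.exp.mul (hasDerivAt_hermiteFn hb n y)).const_mul (√(2 * b))).congr_deriv ?_
    simp only [kernel]
    rw [hermiteFn_succ]
    linear_combination (-Real.exp (-α * (x ^ 2 + y ^ 2) + 2 * α * r * x * y) *
      (2 * √(2 * b) * y * hermiteFn b n y - 2 * n * hermiteFn b (n - 1) y)) * hss
  have hsum : Integrable fun y => 2 * n * (α - b) * (kernel α r x y * hermiteFn b (n - 1) y)
      + (α + b) * (kernel α r x y * hermiteFn b (n + 1) y) :=
    ((hI (n - 1)).const_mul _).add ((hI (n + 1)).const_mul _)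
  have h := integral_eq_zero_of_hasDerivAt_of_integrable hd (((hI n).const_mul _).sub hsum)
    ((hI n).const_mul _)
  rw [integral_sub ((hI n).const_mul _) hsum,
    integral_add ((hI (n - 1)).const_mul _) ((hI (n + 1)).const_mul _), integral_const_mul,
    integral_const_mul, integral_const_mul] at h
  linarith

theorem integral_kernel_mul_hermiteFn (hα : 0 < α) (hr : |r| < 1) (n : ℕ) (x : ℝ) :
    ∫ y, kernel α r x y * hermiteFn (beta α r) n y = mu α r n * hermiteFn (beta α r) n x := by
  have hb := beta_pos hα hr
  have hab : α + beta α r ≠ 0 := by positivity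
  have h1 := sub_beta_eq hα hr
  have h2 : α * r / (α + beta α r) * (α + beta α r) = α * r := by field_simp
  induction n using Nat.twoStepInduction with
  | zero => rw [integral_kernel_mul_hermiteFn_zero hα hr, mu, pow_zero, mul_one]
  | one =>
    have h := integral_kernel_mul_hermiteFn_succ hα hr 0 x
    rw [integral_kernel_mul_hermiteFn_zero hα hr] at h
    refine mul_left_cancel₀ hab (h.trans ?_)
    rw [hermiteFn_succ (beta α r) 0, mu, pow_one]
    simp only [Nat.cast_zero]
    linear_combination (-2 * √(Real.pi / (α + beta α r)) * √(2 * beta α r) * x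
      * hermiteFn (beta α r) 0 x) * h2
  | more n ih0 ih1 =>
    have h := integral_kernel_mul_hermiteFn_succ hα hr (n + 1) x
    rw [Nat.add_sub_cancel, ih0, ih1] at h
    refine mul_left_cancel₀ hab (h.trans ?_)
    rw [hermiteFn_succ (beta α r) (n + 1), Nat.add_sub_cancel, h1]
    simp only [mu]
    set t := α * r / (α + beta α r)
    rw [pow_add, pow_add]
    linear_combination (-2 * √(Real.pi / (α + beta α r)) * √(2 * beta α r) * x
      * hermiteFn (beta α r) (n + 1) x * t ^ n * t) * h2

variable {𝕜 : Type*} [RCLike 𝕜]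

theorem integralOp_hermiteFn (hα : 0 < α) (hr : |r| < 1) (n : ℕ) (x : ℝ) :
    integralOp α r (fun y => (hermiteFn (beta α r) n y : 𝕜)) x =
      (mu α r n : 𝕜) * (hermiteFn (beta α r) n x : 𝕜) := by
  rw [integralOp, ← RCLike.ofReal_mul, ← integral_kernel_mul_hermiteFn hα hr, ← integral_ofReal]
  simp only [RCLike.ofReal_mul]

/-- The integral operator acts diagonally on the Hermite coefficients. -/
theorem integral_hermiteFn_mul_integralOp (hα : 0 < α) (hr : |r| < 1) {f : ℝ → 𝕜}
    (hf : MemLp f 2) (n : ℕ) :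
    ∫ x, (hermiteFn (beta α r) n x : 𝕜) * integralOp α r f x =
      (mu α r n : 𝕜) * ∫ x, (hermiteFn (beta α r) n x : 𝕜) * f x := by
  have hb := beta_pos hα hr
  set b := beta α r
  set c := α * (1 - |r|) with hc
  have hi : Integrable (fun p : ℝ × ℝ => (hermiteFn b n p.1 : 𝕜) *
      ((kernel α r p.1 p.2 : 𝕜) * f p.2)) (volume.prod volume) := by
    refine ((integrable_exp_mul_norm (decay_pos hα hr)
      (memLp_hermiteFn hb n)).mul_prod (integrable_exp_mul_norm (decay_pos hα hr) hf)).mono'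
      ((RCLike.continuous_ofReal.comp ((continuous_hermiteFn b n).comp
        continuous_fst)).aestronglyMeasurable.mul (aestronglyMeasurable_kernel_mul α r hf.1))
      (Filter.Eventually.of_forall fun p => ?_)
    rw [norm_mul, RCLike.norm_ofReal, ← Real.norm_eq_abs]
    calc _ ≤ ‖hermiteFn b n p.1‖ * (Real.exp (-c * p.1 ^ 2) *
          (Real.exp (-c * p.2 ^ 2) * ‖f p.2‖)) := by
          gcongr
          exact norm_kernel_mul_le hα _ _ _
      _ = _ := by ring
  calc ∫ x, (hermiteFn b n x : 𝕜) * integralOp α r f x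
      = ∫ x, ∫ y, (hermiteFn b n x : 𝕜) * ((kernel α r x y : 𝕜) * f y) := by
        simp only [integralOp, integral_const_mul]
    _ = ∫ y, ∫ x, (hermiteFn b n x : 𝕜) * ((kernel α r x y : 𝕜) * f y) :=
        integral_integral_swap hi
    _ = ∫ y, (mu α r n : 𝕜) * ((hermiteFn b n y : 𝕜) * f y) := by
        refine integral_congr_ae (Filter.Eventually.of_forall fun y => ?_)
        simp only
        rw [← mul_assoc, ← integralOp_hermiteFn hα hr, integralOp, ← integral_mul_const]
        refine integral_congr_ae (Filter.Eventually.of_forall fun x => ?_)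
        -- Symmetry of the kernel turns the inner integral over `x` into `K` applied to `h n`.
        simp only [kernel_symm α r y x]
        ring
    _ = _ := integral_const_mul _ _

end Eigen

/-! ### Eigenvalues and their simplicity -/

section Spectrum

variable {𝕜 : Type*} [RCLike 𝕜] {α r : ℝ} {f : ℝ → 𝕜}

theorem mu_zero (α r : ℝ) : mu α r 0 = √(Real.pi / (α + beta α r)) := by
  rw [mu, pow_zero, mul_one]

theorem mu_zero_pos (hα : 0 < α) (hr : |r| < 1) : 0 < mu α r 0 := by
  have hb := beta_pos hα hr
  have := Real.pi_pos
  rw [mu_zero]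
  positivity

theorem abs_mu (α r : ℝ) (n : ℕ) :
    |mu α r n| = mu α r 0 * |α * r / (α + beta α r)| ^ n := by
  rw [mu_zero, mu, abs_mul, abs_pow, abs_of_nonneg (Real.sqrt_nonneg _)]

theorem abs_mu_lt (hα : 0 < α) (hr : |r| < 1) {n : ℕ} (hn : n ≠ 0) :
    |mu α r n| < mu α r 0 := by
  rw [abs_mu]
  exact mul_lt_of_lt_one_right (mu_zero_pos hα hr)
    (pow_lt_one₀ (abs_nonneg _) (ratio_abs_lt_one hα hr) hn)

/-- For `t ≠ 0` already the absolute values are distinct, being geometric; for `t = 0` only `μ_0` is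
nonzero. -/
theorem mu_ne_mu (hα : 0 < α) (hr : |r| < 1) {n k : ℕ} (hn : mu α r n ≠ 0) (hk : k ≠ n) :
    mu α r k ≠ mu α r n := by
  intro h
  have h1 := congrArg abs h
  rw [abs_mu, abs_mu] at h1
  have h2 := mul_left_cancel₀ (mu_zero_pos hα hr).ne' h1
  have hlt := ratio_abs_lt_one hα hr
  rcases (abs_nonneg (α * r / (α + beta α r))).eq_or_lt with h0 | h0
  · have ht := abs_eq_zero.1 h0.symm
    rcases Nat.eq_zero_or_pos n with rfl | hn0
    · rw [← h0, pow_zero, zero_pow hk] at h2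
      exact zero_ne_one h2
    · rw [mu, ht, zero_pow hn0.ne', mul_zero] at hn
      exact hn rfl
  · exact hk (pow_right_injective₀ h0 hlt.ne h2)

theorem IsEigenfunction.mul_coeff {m : 𝕜} (hα : 0 < α) (hr : |r| < 1)
    (h : IsEigenfunction α r m f) (n : ℕ) :
    m * ∫ x, (hermiteFn (beta α r) n x : 𝕜) * f x =
      (mu α r n : 𝕜) * ∫ x, (hermiteFn (beta α r) n x : 𝕜) * f x := by
  rw [← integral_hermiteFn_mul_integralOp hα hr h.1, ← integral_const_mul]
  refine integral_congr_ae ?_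
  filter_upwards [h.2.2] with x hx
  rw [hx]
  ring

theorem IsEigenfunction.exists_eq_mu {m : 𝕜} (hα : 0 < α) (hr : |r| < 1)
    (h : IsEigenfunction α r m f) : ∃ n, m = (mu α r n : 𝕜) := by
  by_contra! hm
  refine h.2.1 (ae_eq_zero_of_integral_hermiteFn (beta_pos hα hr) h.1 fun n => ?_)
  by_contra hn
  exact hm n (mul_right_cancel₀ hn (h.mul_coeff hα hr n))

theorem hermiteFn_not_ae_zero {b : ℝ} (hb : 0 < b) (n : ℕ) :
    ¬ (fun x => (hermiteFn b n x : 𝕜)) =ᵐ[volume] 0 := fun h => by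
  refine (integral_hermiteFn_mul_self_pos hb n).ne' (integral_eq_zero_of_ae ?_)
  filter_upwards [h] with x hx
  have : hermiteFn b n x = 0 := by simpa using hx
  simp [this]

theorem isEigenfunction_hermiteFn (hα : 0 < α) (hr : |r| < 1) (n : ℕ) :
    IsEigenfunction α r (mu α r n : 𝕜) fun x => (hermiteFn (beta α r) n x : 𝕜) :=
  ⟨(memLp_hermiteFn (beta_pos hα hr) n).ofReal, hermiteFn_not_ae_zero (beta_pos hα hr) n,
    Filter.Eventually.of_forall (integralOp_hermiteFn hα hr n)⟩

theorem isEigenvalue_mu (hα : 0 < α) (hr : |r| < 1) (n : ℕ) :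
    IsEigenvalue α r (mu α r n : 𝕜) :=
  ⟨_, isEigenfunction_hermiteFn hα hr n⟩

theorem integral_hermiteFn_mul_hermiteFn (b : ℝ) (n m : ℕ) :
    ∫ x, (hermiteFn b n x : 𝕜) * (hermiteFn b m x : 𝕜) =
      ((∫ x, hermiteFn b n x * hermiteFn b m x : ℝ) : 𝕜) := by
  rw [← integral_ofReal]
  simp only [RCLike.ofReal_mul]

theorem integralOp_congr_ae {g : ℝ → 𝕜} (h : f =ᵐ[volume] g) (x : ℝ) :
    integralOp α r f x = integralOp α r g x := by
  refine integral_congr_ae ?_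
  filter_upwards [h] with y hy
  rw [hy]

theorem isEigenfunction_mu_iff (hα : 0 < α) (hr : |r| < 1) {n : ℕ} (hn : mu α r n ≠ 0) :
    IsEigenfunction α r (mu α r n : 𝕜) f ↔
      ∃ c : 𝕜, c ≠ 0 ∧ f =ᵐ[volume] fun x => c * (hermiteFn (beta α r) n x : 𝕜) := by
  have hb := beta_pos hα hr
  have hF := fun k => (memLp_hermiteFn hb k).ofReal (K := 𝕜)
  constructor
  · intro h
    set G : ℝ := ∫ x, hermiteFn (beta α r) n x * hermiteFn (beta α r) n x
    have hG : (G : 𝕜) ≠ 0 :=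
      RCLike.ofReal_ne_zero.2 (integral_hermiteFn_mul_self_pos hb n).ne'
    set c : 𝕜 := (∫ x, (hermiteFn (beta α r) n x : 𝕜) * f x) / (G : 𝕜) with hc
    -- Subtracting the projection onto `h n` kills coefficient `n`; the others vanish because `μ_k ≠
    -- μ_n`.
    have h0 := ae_eq_zero_of_integral_hermiteFn hb
      (f := fun x => f x - c * (hermiteFn (beta α r) n x : 𝕜)) (h.1.sub ((hF n).const_mul c))
      fun k => by
        have hs : ∀ x, (hermiteFn (beta α r) k x : 𝕜) *
            (f x - c * (hermiteFn (beta α r) n x : 𝕜)) =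
            (hermiteFn (beta α r) k x : 𝕜) * f x -
              c * ((hermiteFn (beta α r) k x : 𝕜) * (hermiteFn (beta α r) n x : 𝕜)) :=
          fun x => by ring
        simp only [hs]
        have hkf : Integrable fun x => (hermiteFn (beta α r) k x : 𝕜) * f x :=
          (hF k).integrable_mul h.1
        have hkn : Integrable fun x =>
            (hermiteFn (beta α r) k x : 𝕜) * (hermiteFn (beta α r) n x : 𝕜) :=
          (hF k).integrable_mul (hF n)
        rw [integral_sub hkf (hkn.const_mul c), integral_const_mul,
          integral_hermiteFn_mul_hermiteFn]
        by_cases hk : k = n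
        · subst hk
          rw [hc, div_mul_cancel₀ _ hG, sub_self]
        · rw [integral_hermiteFn_mul_of_ne hb hk, RCLike.ofReal_zero, mul_zero, sub_zero]
          by_contra h1
          exact mu_ne_mu hα hr hn hk
            (RCLike.ofReal_injective (mul_right_cancel₀ h1 (h.mul_coeff hα hr k))).symm
    have hfc : f =ᵐ[volume] fun x => c * (hermiteFn (beta α r) n x : 𝕜) := by
      filter_upwards [h0] with x hx
      exact sub_eq_zero.1 hx
    refine ⟨c, fun hc0 => h.2.1 ?_, hfc⟩
    filter_upwards [hfc] with x hx
    rw [hx, hc0, zero_mul, Pi.zero_apply]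
  · rintro ⟨c, hc, hfc⟩
    refine ⟨(memLp_congr_ae hfc).2 ((hF n).const_mul c), fun h0 => ?_, ?_⟩
    · refine hermiteFn_not_ae_zero (𝕜 := 𝕜) hb n ?_
      filter_upwards [hfc, h0] with x hx hx0
      rw [hx0] at hx
      exact (mul_eq_zero.1 hx.symm).resolve_left hc
    · filter_upwards [hfc] with x hx
      have h1 := integralOp_hermiteFn (𝕜 := 𝕜) hα hr n x
      rw [integralOp] at h1
      rw [integralOp_congr_ae hfc, hx, integralOp, mul_left_comm, ← h1, ← integral_const_mul]
      simp only [mul_left_comm]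

end Spectrum

/-! ### The orthonormal basis -/

section Basis

variable (𝕜 : Type*) [RCLike 𝕜]

/-- The normalized Hermite functions form an orthonormal basis of `L²`. -/
theorem exists_hilbertBasis_hermiteFn {b : ℝ} (hb : 0 < b) :
    ∃ N : ℕ → ℝ, (∀ n, 0 < N n) ∧ ∃ B : HilbertBasis ℕ 𝕜 (Lp 𝕜 2 (volume : Measure ℝ)),
      ∀ n : ℕ, (B n : ℝ → 𝕜) =ᵐ[volume] fun x => (N n : 𝕜) * (hermiteFn b n x : 𝕜) := by
  set G : ℕ → ℝ := fun n => ∫ x, hermiteFn b n x * hermiteFn b n x with hG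
  have hGp : ∀ n, 0 < G n := integral_hermiteFn_mul_self_pos hb
  set N : ℕ → ℝ := fun n => (√(G n))⁻¹ with hN
  have hNp : ∀ n, 0 < N n := fun n => inv_pos.2 (Real.sqrt_pos.2 (hGp n))
  have hF : ∀ n, MemLp (fun x => (N n : 𝕜) * (hermiteFn b n x : 𝕜)) 2 volume := fun n =>
    ((memLp_hermiteFn hb n).ofReal (K := 𝕜)).const_mul _
  let v : ℕ → Lp 𝕜 2 (volume : Measure ℝ) := fun n => (hF n).toLp _
  have hv : ∀ n, (v n : ℝ → 𝕜) =ᵐ[volume] fun x => (N n : 𝕜) * (hermiteFn b n x : 𝕜) :=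
    fun n => (hF n).coeFn_toLp
  have hin : ∀ n (f : Lp 𝕜 2 (volume : Measure ℝ)),
      inner 𝕜 (v n) f = (N n : 𝕜) * ∫ x, (hermiteFn b n x : 𝕜) * f x := fun n f => by
    rw [L2.inner_def, ← integral_const_mul]
    refine integral_congr_ae ?_
    filter_upwards [hv n] with x hx
    rw [hx, RCLike.inner_apply, ← RCLike.ofReal_mul, RCLike.conj_ofReal]
    push_cast
    ring
  have hvv : ∀ n m, inner 𝕜 (v n) (v m) =
      ((N n * (N m * ∫ x, hermiteFn b n x * hermiteFn b m x) : ℝ) : 𝕜) := fun n m => by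
    rw [hin, RCLike.ofReal_mul, RCLike.ofReal_mul, ← integral_hermiteFn_mul_hermiteFn,
      ← integral_const_mul (N m : 𝕜)]
    congr 1
    refine integral_congr_ae ?_
    filter_upwards [hv m] with x hx
    rw [hx]
    ring
  have hon : Orthonormal 𝕜 v := by
    rw [orthonormal_iff_ite]
    intro n m
    rw [hvv]
    split_ifs with h
    · subst h
      have : N n * (N n * G n) = 1 := by
        have h1 : √(G n) ≠ 0 := (Real.sqrt_pos.2 (hGp n)).ne'
        have h2 := Real.mul_self_sqrt (hGp n).le
        simp only [hN]
        field_simp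
        rw [sq, h2]
      rw [this, RCLike.ofReal_one]
    · rw [integral_hermiteFn_mul_of_ne hb h]
      simp
  refine ⟨N, hNp, HilbertBasis.mkOfOrthogonalEqBot hon ?_, fun n => ?_⟩
  -- Totality says that the orthogonal complement of the span is trivial.
  · rw [Submodule.eq_bot_iff]
    intro f hf
    rw [Lp.eq_zero_iff_ae_eq_zero]
    refine ae_eq_zero_of_integral_hermiteFn hb (Lp.memLp f) fun n => ?_
    have h := (Submodule.mem_orthogonal _ _).1 hf (v n)
      (Submodule.subset_span (Set.mem_range_self n))
    rw [hin] at h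
    exact (mul_eq_zero.1 h).resolve_left (RCLike.ofReal_ne_zero.2 (hNp n).ne')
  · rw [HilbertBasis.coe_mkOfOrthogonalEqBot]
    exact hv n

end Basis

/-! ### The trace identity -/

section Trace

variable {α r : ℝ}

theorem hasSum_mu (hα : 0 < α) (hr : |r| < 1) :
    HasSum (mu α r) (√(Real.pi / (2 * α * (1 - r)))) := by
  have hb := beta_pos hα hr
  have h2 := beta_sq (α := α) hr
  obtain ⟨hr1, hr2⟩ := abs_lt.1 hr
  have h1r : 0 < 1 - r := by linarith
  have hlt := ratio_abs_lt_one hα hr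
  have h := (hasSum_geometric_of_abs_lt_one hlt).mul_left (√(Real.pi / (α + beta α r)))
  have hd : 0 < α + beta α r - α * r := by nlinarith
  have hinv : (1 - α * r / (α + beta α r))⁻¹ =
      (α + beta α r) / (α + beta α r - α * r) := by
    field_simp
  have hpos : 0 ≤ (α + beta α r) / (α + beta α r - α * r) := by positivity
  -- Under the root this reduces to `(α + β - αr)² = 2α(1 - r)(α + β)`, a consequence of `β² = α²(1
  -- - r²)`.
  have hval : √(Real.pi / (α + beta α r)) * (1 - α * r / (α + beta α r))⁻¹ =
      √(Real.pi / (2 * α * (1 - r))) := by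
    rw [hinv, ← Real.sqrt_sq hpos, ← Real.sqrt_mul (by have := Real.pi_pos; positivity)]
    congr 1
    field_simp
    linear_combination -h2
  rw [hval] at h
  exact h

theorem kernel_diag (α r x : ℝ) : kernel α r x x = Real.exp (-(2 * α * (1 - r)) * x ^ 2) := by
  unfold kernel
  congr 1
  ring

end Trace

end GaussKernel

end

theorem mainTheorem6 {𝕜 : Type*} [RCLike 𝕜] (α r : ℝ) (hα : 0 < α)
    (hr₁ : -1 < r) (hr₂ : r < 1) :
    -- the integral operator is defined on all of `L²` and maps `L²` to `L²`
    (∀ f : ℝ → 𝕜, MemLp f 2 (volume : Measure ℝ) →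
      (∀ x : ℝ, Integrable (fun y : ℝ => (GaussKernel.kernel α r x y : 𝕜) * f y) volume) ∧
      MemLp (GaussKernel.integralOp α r f) 2 (volume : Measure ℝ)) ∧
    -- each `φ_n` is an eigenfunction with eigenvalue `μ_n`, the equation holding at every point
    (∀ n : ℕ,
      GaussKernel.IsEigenfunction α r (GaussKernel.mu α r n : 𝕜)
        (fun x => (GaussKernel.phi α r n x : 𝕜)) ∧
      ∀ x : ℝ, GaussKernel.integralOp α r (fun y => (GaussKernel.phi α r n y : 𝕜)) x =
        (GaussKernel.mu α r n : 𝕜) * (GaussKernel.phi α r n x : 𝕜)) ∧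
    -- the normalized `φ_n` form an orthonormal basis of `L²`
    (∃ N : ℕ → ℝ, (∀ n, 0 < N n) ∧
      ∃ b : HilbertBasis ℕ 𝕜 (Lp 𝕜 2 (volume : Measure ℝ)),
        ∀ n : ℕ, (b n : ℝ → 𝕜) =ᵐ[volume]
          fun x => (N n : 𝕜) * (GaussKernel.phi α r n x : 𝕜)) ∧
    -- they are the eigenfunctions of a harmonic oscillator of frequency `2β`
    (∀ (n : ℕ) (x : ℝ),
      -(1 / 2) * iteratedDeriv 2 (GaussKernel.phi α r n) x
          + (1 / 2) * (2 * GaussKernel.beta α r) ^ 2 * x ^ 2 * GaussKernel.phi α r n x =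
        2 * GaussKernel.beta α r * ((n : ℝ) + 1 / 2) * GaussKernel.phi α r n x) ∧
    -- there are no other eigenvalues
    {m : 𝕜 | GaussKernel.IsEigenvalue α r m} =
      Set.range (fun n : ℕ => (GaussKernel.mu α r n : 𝕜)) ∧
    -- every nonzero `μ_n` is simple
    (∀ n : ℕ, GaussKernel.mu α r n ≠ 0 → ∀ f : ℝ → 𝕜,
      GaussKernel.IsEigenfunction α r (GaussKernel.mu α r n : 𝕜) f ↔
        ∃ c : 𝕜, c ≠ 0 ∧ f =ᵐ[volume] fun x => c * (GaussKernel.phi α r n x : 𝕜)) ∧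
    -- the trace identity
    HasSum (GaussKernel.mu α r) (√(Real.pi / (2 * α * (1 - r)))) ∧
    Integrable (fun x : ℝ => GaussKernel.kernel α r x x) volume ∧
    ∫ x : ℝ, GaussKernel.kernel α r x x = √(Real.pi / (2 * α * (1 - r))) ∧
    -- the largest eigenvalue, also in absolute value, belongs to the Gaussian eigenfunction only
    IsGreatest {m : ℝ | GaussKernel.IsEigenvalue α r (m : 𝕜)}
      (√(Real.pi / (α + GaussKernel.beta α r))) ∧
    (∀ m : 𝕜, GaussKernel.IsEigenvalue α r m →
      m ≠ ((√(Real.pi / (α + GaussKernel.beta α r)) : ℝ) : 𝕜) →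
      ‖m‖ < √(Real.pi / (α + GaussKernel.beta α r))) ∧
    (∀ f : ℝ → 𝕜,
      GaussKernel.IsEigenfunction α r
          ((√(Real.pi / (α + GaussKernel.beta α r)) : ℝ) : 𝕜) f ↔
        ∃ c : 𝕜, c ≠ 0 ∧
          f =ᵐ[volume] fun x => c * (Real.exp (-GaussKernel.beta α r * x ^ 2) : 𝕜)) := by
  have hr : |r| < 1 := abs_lt.2 ⟨hr₁, hr₂⟩
  have hb := GaussKernel.beta_pos hα hr
  -- Reading the square root as `μ_0` lets the claims on the largest eigenvalue use the results for
  -- general `n`.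
  simp only [GaussKernel.phi_eq_hermiteFn, ← GaussKernel.mu_zero]
  refine ⟨fun f hf => ⟨GaussKernel.integrable_kernel_mul hα hr hf,
      GaussKernel.memLp_integralOp hα hr hf⟩,
    fun n => ⟨GaussKernel.isEigenfunction_hermiteFn hα hr n,
      GaussKernel.integralOp_hermiteFn hα hr n⟩,
    GaussKernel.exists_hilbertBasis_hermiteFn 𝕜 hb, GaussKernel.hermiteFn_oscillator hb,
    ?_, fun n hn f => GaussKernel.isEigenfunction_mu_iff hα hr hn,
    GaussKernel.hasSum_mu hα hr, ?_, ?_,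
    ⟨GaussKernel.isEigenvalue_mu hα hr 0, ?_⟩, ?_, fun f => ?_⟩
  · ext m
    constructor
    · rintro ⟨f, hf⟩
      obtain ⟨n, hn⟩ := hf.exists_eq_mu hα hr
      exact ⟨n, hn.symm⟩
    · rintro ⟨n, rfl⟩
      exact GaussKernel.isEigenvalue_mu hα hr n
  · simp only [GaussKernel.kernel_diag]
    exact integrable_exp_neg_mul_sq (mul_pos (by positivity) (sub_pos.2 hr₂))
  · simp only [GaussKernel.kernel_diag, integral_gaussian]
  · rintro m ⟨f, hf⟩
    obtain ⟨n, hn⟩ := hf.exists_eq_mu hα hr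
    rw [RCLike.ofReal_injective hn]
    rcases eq_or_ne n 0 with rfl | h0
    · exact le_rfl
    · exact (le_abs_self _).trans (GaussKernel.abs_mu_lt hα hr h0).le
  · rintro m ⟨f, hf⟩ hm
    obtain ⟨n, rfl⟩ := hf.exists_eq_mu hα hr
    rw [RCLike.norm_ofReal]
    exact GaussKernel.abs_mu_lt hα hr fun h0 => hm (by rw [h0])
  · simpa only [GaussKernel.hermiteFn_zero] using
      GaussKernel.isEigenfunction_mu_iff hα hr (GaussKernel.mu_zero_pos hα hr).ne'
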